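/- Let $\mathcal E$ be the set of closed expressions built from the constant $1$ and a binary symbol $E$, with values $[\![1]\!]=1$ and $[\![E(\alpha,\beta)]\!]=\exp([\![\alpha]\!])-\log([\![\beta]\!])$, where $\log$ is the principal branch ($-\pi<\operatorname{Im}\log\le\pi$). The value of $E(\alpha,\beta)$ is defined when those of $\alpha$ and $\beta$ are defined and $[\![\beta]\!]\neq0$. Let $\mathrm{EML}\subseteq\mathbb C$ be the set of all defined values. A real $x$ is computable if an algorithm outputs, on each input $k\in\mathbb N$, a rational within $2^{-k}$ of $x$. Then the set of non-computable reals has full Lebesgue measure (its complement in $\mathbb R$ is a null set) and is disjoint from $\mathrm{EML}$. Moreover, all of the following reals are non-computable and hence do not belong to $\mathrm{EML}$: 1. Chaitin's $\Omega_U=\sum_{p\in\operatorname{dom}U}2^{-|p|}$, for every universal prefix-free machine $U$. Here a prefix-free machine is a partial computable function on binary strings whose domain contains no string together with a proper extension of it, and $U$ is universal if for every prefix-free machine $M$ there is a string $r$ with $U(rp)\simeq M(p)$ for all $p$. 2. The real $0.\chi_H(1)\chi_H(2)\chi_H(3)\ldots=\sum_{n\ge1}\chi_H(n)2^{-n}$,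 where $H\subseteq\mathbb N$ is the halting set (for a standard numbering $\varphi_0,\varphi_1,\dots$ of the partial recursive functions), in any of the usual forms $\{\langle e,x\rangle:\varphi_e(x)\downarrow\}$, $\{e:\varphi_e(e)\downarrow\}$, or $\{e:\varphi_e(m)\downarrow\}$ for a fixed input $m$. 3. The limit of every Specker sequence, that is, of every computable, increasing (not necessarily strictly), bounded sequence of rationals whose supremum is not a computable real. In particular, for every injective computable $a:\mathbb N\to\mathbb N$ with undecidable range, the sequence $q_n=\sum_{i<n}2^{-a(i)-1}$ is a Specker sequence. 4. Every Martin-Löf random real, that is, every $x\in\mathbb R$ such that $x\notin\bigcap_n U_n$ whenever $(U_n)_{n\in\mathbb N}$ is a uniformly computably enumerable sequence of open sets (each $U_n=\bigcup_i (a_{n,i},b_{n,i})$ with rationals $a_{n,i},b_{n,i}$ computable from $(n,i)$) with Lebesgue measure $\lambda(U_n)\le2^{-n}$. -/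

import Mathlib

/-- Closed EML expressions: the constant `1` and the binary operator `E`. -/
inductive EMLExpr : Type
  | one : EMLExpr
  | E : EMLExpr → EMLExpr → EMLExpr

namespace EMLExpr

/-- The value of an expression: `1` has value `1` and `E(α, β)` has value `exp α - log β`, with the
principal branch of the logarithm (imaginary part in `(-π, π]`). It is meaningful only for
expressions that are `Defined`. -/
noncomputable def value : EMLExpr → ℂ
  | one => 1
  | E α β => Complex.exp (value α) - Complex.log (value β)

/-- An expression is defined if no logarithm of `0` is taken anywhere in it. -/
def Defined : EMLExpr → Prop
  | one => True
  | E α β => Defined α ∧ Defined β ∧ value β ≠ 0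

end EMLExpr

/-- The set of EML numbers: the values of the defined closed EML expressions. -/
def EML : Set ℂ := {z | ∃ φ : EMLExpr, φ.Defined ∧ φ.value = z}

/-- A computable family of rationals, written as `(f a - g a) / (h a + 1)` with total recursive
`f`, `g`, `h`. -/
def IsComputableRat {α : Type} [Primcodable α] (q : α → ℚ) : Prop :=
  ∃ f g h : α → ℕ, Computable f ∧ Computable g ∧ Computable h ∧
    ∀ a, q a = ((f a : ℚ) - (g a : ℚ)) / ((h a : ℚ) + 1)

/-- A real is computable if some algorithm outputs, on input `k`, a rational within `2^(-k)`
of it. -/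
def IsComputableReal (x : ℝ) : Prop :=
  ∃ q : ℕ → ℚ, IsComputableRat q ∧ ∀ k : ℕ, |x - (q k : ℝ)| ≤ 1 / 2 ^ k

/-- The set of non-computable reals. -/
def noncomputableReals : Set ℝ := {x | ¬ IsComputableReal x}

open Classical in
/-- The real `0.χ_A(1) χ_A(2) χ_A(3) …` in binary, where `χ_A` is the characteristic function
of `A`. -/
noncomputable def binaryReal (A : Set ℕ) : ℝ :=
  ∑' n : ℕ, (if n + 1 ∈ A then (1 : ℝ) else 0) / 2 ^ (n + 1)

/-- The partial recursive function computed by the program with number `e`. -/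
def program (e : ℕ) : ℕ →. ℕ :=
  Nat.Partrec.Code.eval (Denumerable.ofNat Nat.Partrec.Code e)

/-- The halting set: the (numbers of) pairs of a program and an input on which it halts. -/
def haltingSet : Set ℕ := {n | (program n.unpair.1 n.unpair.2).Dom}

/-- The diagonal halting set: the programs that halt on their own number. -/
def selfHaltingSet : Set ℕ := {e | (program e e).Dom}

/-- The halting set for a fixed input `m`: the programs that halt on input `m`. -/
def inputHaltingSet (m : ℕ) : Set ℕ := {e | (program e m).Dom}

/-- A Specker sequence: a computable, increasing, bounded sequence of rationals whose supremum
(equivalently, limit) is not a computable real. -/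
structure IsSpeckerSequence (q : ℕ → ℚ) : Prop where
  computable : IsComputableRat q
  monotone : Monotone q
  bounded : BddAbove (Set.range fun n => (q n : ℝ))
  noncomputable_sup : ¬ IsComputableReal (⨆ n, (q n : ℝ))

/-- A Martin-Löf test: a uniformly computably enumerable sequence of open sets
`U n = ⋃ i, (a (n, i), b (n, i))` of Lebesgue measure at most `2^(-n)`, where the endpoints are
rationals computable from `(n, i)`. (The interval is empty when `b (n, i) ≤ a (n, i)`.) -/
def IsMartinLofTest (U : ℕ → Set ℝ) : Prop :=
  (∃ a b : ℕ × ℕ → ℚ, IsComputableRat a ∧ IsComputableRat b ∧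
    ∀ n, U n = ⋃ i : ℕ, Set.Ioo (a (n, i) : ℝ) (b (n, i) : ℝ)) ∧
  ∀ n, MeasureTheory.volume (U n) ≤ ENNReal.ofReal (1 / 2 ^ n)

/-- A real is Martin-Löf random if it passes every Martin-Löf test. -/
def IsMartinLofRandom (x : ℝ) : Prop :=
  ∀ U : ℕ → Set ℝ, IsMartinLofTest U → x ∉ ⋂ n, U n

/-- A prefix-free machine: a partial computable function on binary strings whose domain contains
no string together with a proper extension of it. -/
def IsPrefixFreeMachine (M : List Bool →. List Bool) : Prop :=
  Partrec M ∧ ∀ p q : List Bool, (M p).Dom → (M q).Dom → p <+: q → p = q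

/-- A universal prefix-free machine: it simulates every prefix-free machine `M` when the input is
preceded by a suitable string depending only on `M`. -/
def IsUniversalPrefixFreeMachine (U : List Bool →. List Bool) : Prop :=
  IsPrefixFreeMachine U ∧
    ∀ M : List Bool →. List Bool, IsPrefixFreeMachine M →
      ∃ r : List Bool, ∀ p : List Bool, U (r ++ p) = M p

/-- Chaitin's halting probability `Ω_U`, the sum of `2^(-|p|)` over `p` in the domain of `U`. -/
noncomputable def chaitinOmega (U : List Bool →. List Bool) : ℝ :=
  ∑' p : {p : List Bool // (U p).Dom}, (1 : ℝ) / 2 ^ p.1.length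

/-! The computable complex numbers contain 1 and are closed under subtraction, under `exp`, and
under the principal `log` away from 0 (`IsComputableComplex.exp`, `IsComputableComplex.log`). By
induction every EML value is computable, so no non-computable real is in EML. Both closure
properties come from `IsComputableComplex.powerSeries`; scaling by a power of 2 and rotating by a
quarter or half turn bring every nonzero number into the disc where the series of `log` converges.

There are only countably many algorithms, hence countably many computable reals, and a countable set
is null.

The halting reals, Chaitin's numbers and the classical Specker sequences rest on
`computablePred_of_hasSum`. If P is recursively enumerable and the sum of 2^(-l n) over P is
computable, P can be decided: enumerate P until the missing weight is provably below 2^(-l n); an n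
not yet seen never appears. Undecidability of the halting problem then gives non-computability. A
Martin-Löf random real is non-computable because the approximations to a computable real form a test
that captures it. -/

/-! ### Computable arithmetic on naturals and rationals -/

theorem Computable.nat_add {α : Type*} [Primcodable α] {f g : α → ℕ} (hf : Computable f)
    (hg : Computable g) : Computable fun a => f a + g a :=
  Primrec.nat_add.to_comp.comp hf hg

theorem Computable.nat_sub {α : Type*} [Primcodable α] {f g : α → ℕ} (hf : Computable f)
    (hg : Computable g) : Computable fun a => f a - g a :=
  Primrec.nat_sub.to_comp.comp hf hg

theorem Computable.nat_mul {α : Type*} [Primcodable α] {f g : α → ℕ} (hf : Computable f)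
    (hg : Computable g) : Computable fun a => f a * g a :=
  Primrec.nat_mul.to_comp.comp hf hg

theorem Computable.nat_pow {α : Type*} [Primcodable α] {f g : α → ℕ} (hf : Computable f)
    (hg : Computable g) : Computable fun a => f a ^ g a :=
  (Primrec₂.unpaired'.1 Nat.Primrec.pow).to_comp.comp hf hg

theorem Computable.factorial {α : Type*} [Primcodable α] {f : α → ℕ} (hf : Computable f) :
    Computable fun a => (f a).factorial := by
  refine (Computable.nat_rec (h := fun _ p => (p.1 + 1) * p.2) hf (Computable.const 1)
    ?_).of_eq fun a => ?_
  · exact (((Computable.fst.comp Computable.snd).nat_add (Computable.const 1)).nat_mul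
      (Computable.snd.comp Computable.snd)).to₂
  · induction f a with
    | zero => rfl
    | succ n ih => simp only [Nat.factorial, ← ih]

/-- The rational number `(a - b) / (h + 1)` coded by `(a, b, h)`. -/
def ratVal (r : ℕ × ℕ × ℕ) : ℚ := ((r.1 : ℚ) - r.2.1) / ((r.2.2 : ℚ) + 1)

/-- Addition on codes of rationals. -/
def ratAdd (r s : ℕ × ℕ × ℕ) : ℕ × ℕ × ℕ :=
  (r.1 * (s.2.2 + 1) + s.1 * (r.2.2 + 1), r.2.1 * (s.2.2 + 1) + s.2.1 * (r.2.2 + 1),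
    r.2.2 * s.2.2 + r.2.2 + s.2.2)

/-- Multiplication on codes of rationals. -/
def ratMul (r s : ℕ × ℕ × ℕ) : ℕ × ℕ × ℕ :=
  (r.1 * s.1 + r.2.1 * s.2.1, r.1 * s.2.1 + r.2.1 * s.1, r.2.2 * s.2.2 + r.2.2 + s.2.2)

/-- Negation on codes of rationals. -/
def ratNeg (r : ℕ × ℕ × ℕ) : ℕ × ℕ × ℕ := (r.2.1, r.1, r.2.2)

theorem ratVal_add (r s : ℕ × ℕ × ℕ) : ratVal (ratAdd r s) = ratVal r + ratVal s := by
  have h1 : (r.2.2 : ℚ) + 1 ≠ 0 := by positivity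
  have h2 : (s.2.2 : ℚ) + 1 ≠ 0 := by positivity
  -- Codes store the denominator less one, and this expression is the product of the two
  -- denominators.
  have h3 : (r.2.2 * s.2.2 + r.2.2 + s.2.2 : ℚ) + 1 ≠ 0 := by positivity
  simp only [ratVal, ratAdd]
  push_cast
  rw [div_add_div _ _ h1 h2, div_eq_div_iff h3 (mul_ne_zero h1 h2)]
  ring

theorem ratVal_mul (r s : ℕ × ℕ × ℕ) : ratVal (ratMul r s) = ratVal r * ratVal s := by
  have h1 : (r.2.2 : ℚ) + 1 ≠ 0 := by positivity
  have h2 : (s.2.2 : ℚ) + 1 ≠ 0 := by positivity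
  have h3 : (r.2.2 * s.2.2 + r.2.2 + s.2.2 : ℚ) + 1 ≠ 0 := by positivity
  simp only [ratVal, ratMul]
  push_cast
  rw [div_mul_div_comm, div_eq_div_iff h3 (mul_ne_zero h1 h2)]
  ring

theorem ratVal_neg (r : ℕ × ℕ × ℕ) : ratVal (ratNeg r) = -ratVal r := by
  simp only [ratVal, ratNeg]
  ring

theorem computable_ratAdd {α : Type*} [Primcodable α] {F G : α → ℕ × ℕ × ℕ} (hF : Computable F)
    (hG : Computable G) : Computable fun a => ratAdd (F a) (G a) := by
  have f1 := Computable.fst.comp hF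
  have f2 := Computable.fst.comp (Computable.snd.comp hF)
  have f3 := Computable.snd.comp (Computable.snd.comp hF)
  have g1 := Computable.fst.comp hG
  have g2 := Computable.fst.comp (Computable.snd.comp hG)
  have g3 := Computable.snd.comp (Computable.snd.comp hG)
  have c1 : Computable fun _ : α => 1 := Computable.const 1
  exact ((f1.nat_mul (g3.nat_add c1)).nat_add (g1.nat_mul (f3.nat_add c1))).pair
    (((f2.nat_mul (g3.nat_add c1)).nat_add (g2.nat_mul (f3.nat_add c1))).pair
      (((f3.nat_mul g3).nat_add f3).nat_add g3))

theorem computable_ratMul {α : Type*} [Primcodable α] {F G : α → ℕ × ℕ × ℕ} (hF : Computable F)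
    (hG : Computable G) : Computable fun a => ratMul (F a) (G a) := by
  have f1 := Computable.fst.comp hF
  have f2 := Computable.fst.comp (Computable.snd.comp hF)
  have f3 := Computable.snd.comp (Computable.snd.comp hF)
  have g1 := Computable.fst.comp hG
  have g2 := Computable.fst.comp (Computable.snd.comp hG)
  have g3 := Computable.snd.comp (Computable.snd.comp hG)
  exact ((f1.nat_mul g1).nat_add (f2.nat_mul g2)).pair
    (((f1.nat_mul g2).nat_add (f2.nat_mul g1)).pair (((f3.nat_mul g3).nat_add f3).nat_add g3))

theorem computable_ratNeg {α : Type*} [Primcodable α] {F : α → ℕ × ℕ × ℕ} (hF : Computable F) :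
    Computable fun a => ratNeg (F a) :=
  (Computable.fst.comp (Computable.snd.comp hF)).pair
    ((Computable.fst.comp hF).pair (Computable.snd.comp (Computable.snd.comp hF)))

theorem isComputableRat_iff {α : Type} [Primcodable α] {q : α → ℚ} :
    IsComputableRat q ↔ ∃ F : α → ℕ × ℕ × ℕ, Computable F ∧ ∀ a, q a = ratVal (F a) := by
  constructor
  · rintro ⟨f, g, h, hf, hg, hh, H⟩
    exact ⟨fun a => (f a, g a, h a), hf.pair (hg.pair hh), H⟩
  · rintro ⟨F, hF, H⟩
    exact ⟨_, _, _, Computable.fst.comp hF, Computable.fst.comp (Computable.snd.comp hF),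
      Computable.snd.comp (Computable.snd.comp hF), H⟩

namespace IsComputableRat

variable {α β : Type} [Primcodable α] [Primcodable β] {q r : α → ℚ}

theorem of_eq (hq : IsComputableRat q) (H : ∀ a, q a = r a) : IsComputableRat r :=
  (funext H : q = r) ▸ hq

theorem comp (hq : IsComputableRat q) {f : β → α} (hf : Computable f) :
    IsComputableRat fun b => q (f b) := by
  obtain ⟨F, hF, H⟩ := isComputableRat_iff.1 hq
  exact isComputableRat_iff.2 ⟨_, hF.comp hf, fun b => H (f b)⟩

theorem add (hq : IsComputableRat q) (hr : IsComputableRat r) :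
    IsComputableRat fun a => q a + r a := by
  obtain ⟨F, hF, H⟩ := isComputableRat_iff.1 hq
  obtain ⟨G, hG, K⟩ := isComputableRat_iff.1 hr
  exact isComputableRat_iff.2 ⟨_, computable_ratAdd hF hG, fun a => by rw [ratVal_add, H, K]⟩

theorem mul (hq : IsComputableRat q) (hr : IsComputableRat r) :
    IsComputableRat fun a => q a * r a := by
  obtain ⟨F, hF, H⟩ := isComputableRat_iff.1 hq
  obtain ⟨G, hG, K⟩ := isComputableRat_iff.1 hr
  exact isComputableRat_iff.2 ⟨_, computable_ratMul hF hG, fun a => by rw [ratVal_mul, H, K]⟩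

theorem neg (hq : IsComputableRat q) : IsComputableRat fun a => -q a := by
  obtain ⟨F, hF, H⟩ := isComputableRat_iff.1 hq
  exact isComputableRat_iff.2 ⟨_, computable_ratNeg hF, fun a => by rw [ratVal_neg, H]⟩

theorem sub (hq : IsComputableRat q) (hr : IsComputableRat r) :
    IsComputableRat fun a => q a - r a :=
  (hq.add hr.neg).of_eq fun _ => (sub_eq_add_neg _ _).symm

theorem natCast {f : α → ℕ} (hf : Computable f) : IsComputableRat fun a => (f a : ℚ) :=
  ⟨f, fun _ => 0, fun _ => 0, hf, Computable.const 0, Computable.const 0, fun a => by simp⟩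

theorem inv_natCast {f : α → ℕ} (hf : Computable f) (h0 : ∀ a, f a ≠ 0) :
    IsComputableRat fun a => (f a : ℚ)⁻¹ :=
  ⟨fun _ => 1, fun _ => 0, fun a => f a - 1, Computable.const 1, Computable.const 0,
    hf.nat_sub (Computable.const 1), fun a => by
      rw [Nat.cast_sub (Nat.one_le_iff_ne_zero.2 (h0 a))]
      simp⟩

theorem const (c : ℚ) : IsComputableRat fun _ : α => c := by
  have h : IsComputableRat fun _ : α => (c.den : ℚ)⁻¹ :=
    inv_natCast (Computable.const _) fun _ => c.den_nz
  have h1 : IsComputableRat fun _ : α => (c.num.natAbs : ℚ) := natCast (Computable.const _)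
  rcases Int.natAbs_eq c.num with e | e
  · refine (h1.mul h).of_eq fun _ => ?_
    rw [← div_eq_mul_inv]
    conv_rhs => rw [← Rat.num_div_den c, e]
    simp
  · refine (h1.neg.mul h).of_eq fun _ => ?_
    rw [← div_eq_mul_inv]
    conv_rhs => rw [← Rat.num_div_den c, e]
    simp

theorem one_div_two_pow {f : α → ℕ} (hf : Computable f) :
    IsComputableRat fun a => (1 : ℚ) / 2 ^ f a :=
  (inv_natCast ((Computable.const 2).nat_pow hf) fun _ => by positivity).of_eq fun a => by simp

theorem decide_le (hq : IsComputableRat q) (hr : IsComputableRat r) :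
    Computable fun a => decide (q a ≤ r a) := by
  obtain ⟨f, g, h, hf, hg, hh, H⟩ := hq
  obtain ⟨f', g', h', hf', hg', hh', H'⟩ := hr
  have c1 : Computable fun _ : α => 1 := Computable.const 1
  have key := (Primrec.nat_le.decide).to_comp.comp
    ((hf.nat_mul (hh'.nat_add c1)).nat_add (hg'.nat_mul (hh.nat_add c1)))
    ((hf'.nat_mul (hh.nat_add c1)).nat_add (hg.nat_mul (hh'.nat_add c1)))
  refine key.of_eq fun a => ?_
  rw [decide_eq_decide, H, H', div_le_div_iff₀ (by positivity) (by positivity)]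
  rw [← Nat.cast_le (α := ℚ)]
  push_cast
  constructor <;> intro h <;> linarith

theorem cond {b : α → Bool} (hb : Computable b) (hq : IsComputableRat q)
    (hr : IsComputableRat r) : IsComputableRat fun a => bif b a then q a else r a := by
  obtain ⟨F, hF, H⟩ := isComputableRat_iff.1 hq
  obtain ⟨G, hG, K⟩ := isComputableRat_iff.1 hr
  refine isComputableRat_iff.2 ⟨_, Computable.cond hb hF hG, fun a => ?_⟩
  cases h : b a <;> simp [H, K]

theorem sum_range {q : α × ℕ → ℚ} (hq : IsComputableRat q) {n : α → ℕ} (hn : Computable n) :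
    IsComputableRat fun a => ∑ i ∈ Finset.range (n a), q (a, i) := by
  obtain ⟨F, hF, H⟩ := isComputableRat_iff.1 hq
  have hstep : Computable₂ fun (a : α) (p : ℕ × (ℕ × ℕ × ℕ)) => ratAdd p.2 (F (a, p.1)) :=
    computable_ratAdd (Computable.snd.comp Computable.snd)
      (hF.comp (Computable.fst.pair (Computable.fst.comp Computable.snd)))
  refine isComputableRat_iff.2 ⟨_, Computable.nat_rec hn (Computable.const (0, 0, 0)) hstep,
    fun a => ?_⟩
  induction n a with
  | zero => simp [ratVal]
  | succ m ih => rw [Finset.sum_range_succ, ih, H, ← ratVal_add]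

/-- Real and imaginary parts feed into each other, so one recursion carries both. This evaluates
partial sums of power series at Gaussian rationals. -/
theorem complex_pow (hq : IsComputableRat q) (hr : IsComputableRat r) {n : α → ℕ}
    (hn : Computable n) : ∃ u v : α → ℚ, IsComputableRat u ∧ IsComputableRat v ∧
      ∀ a, ((u a : ℂ) + v a * Complex.I) = ((q a : ℂ) + r a * Complex.I) ^ n a := by
  obtain ⟨F, hF, H⟩ := isComputableRat_iff.1 hq
  obtain ⟨G, hG, K⟩ := isComputableRat_iff.1 hr
  have hstep : Computable₂ fun (a : α) (p : ℕ × ((ℕ × ℕ × ℕ) × (ℕ × ℕ × ℕ))) =>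
      (ratAdd (ratMul p.2.1 (F a)) (ratNeg (ratMul p.2.2 (G a))),
        ratAdd (ratMul p.2.1 (G a)) (ratMul p.2.2 (F a))) := by
    have hs1 : Computable fun x : α × (ℕ × ((ℕ × ℕ × ℕ) × (ℕ × ℕ × ℕ))) => x.2.2.1 :=
      Computable.fst.comp (Computable.snd.comp Computable.snd)
    have hs2 : Computable fun x : α × (ℕ × ((ℕ × ℕ × ℕ) × (ℕ × ℕ × ℕ))) => x.2.2.2 :=
      Computable.snd.comp (Computable.snd.comp Computable.snd)
    have hF' := hF.comp (Computable.fst (α := α) (β := ℕ × ((ℕ × ℕ × ℕ) × (ℕ × ℕ × ℕ))))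
    have hG' := hG.comp (Computable.fst (α := α) (β := ℕ × ((ℕ × ℕ × ℕ) × (ℕ × ℕ × ℕ))))
    exact (computable_ratAdd (computable_ratMul hs1 hF')
      (computable_ratNeg (computable_ratMul hs2 hG'))).pair
        (computable_ratAdd (computable_ratMul hs1 hG') (computable_ratMul hs2 hF'))
  have hrec := Computable.nat_rec hn (Computable.const ((1, 0, 0), (0, 0, 0))) hstep
  refine ⟨_, _, isComputableRat_iff.2 ⟨_, Computable.fst.comp hrec, fun _ => rfl⟩,
    isComputableRat_iff.2 ⟨_, Computable.snd.comp hrec, fun _ => rfl⟩, fun a => ?_⟩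
  simp only []
  induction n a with
  | zero => simp [ratVal]
  | succ m ih =>
    rw [pow_succ, ← ih]
    simp only [ratVal_add, ratVal_mul, ratVal_neg, ← H, ← K]
    generalize (Nat.rec _ _ m : (ℕ × ℕ × ℕ) × (ℕ × ℕ × ℕ)) = s
    push_cast
    linear_combination (-(ratVal s.2 : ℂ) * (r a : ℂ)) * Complex.I_sq

end IsComputableRat

/-! ### Computable complex numbers: closure under arithmetic, `exp` and `log` -/

/-- A complex number is computable if some algorithm outputs, on input `k`, a Gaussian rational
within `O(2^(-k))` of it. -/
def IsComputableComplex (z : ℂ) : Prop :=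
  ∃ a b : ℕ → ℚ, IsComputableRat a ∧ IsComputableRat b ∧
    ∃ C : ℝ, ∀ k : ℕ, ‖z - ((a k : ℂ) + b k * Complex.I)‖ ≤ C / 2 ^ k

namespace IsComputableComplex

/-- With C < 2^M, reading the approximations M places further on absorbs the constant; this is why
the definition can afford an arbitrary C. -/
theorem exists_approx {z : ℂ} (hz : IsComputableComplex z) (N : ℕ) :
    ∃ a b : ℕ → ℚ, IsComputableRat a ∧ IsComputableRat b ∧
      ∀ k : ℕ, ‖z - ((a k : ℂ) + b k * Complex.I)‖ ≤ 1 / 2 ^ (k + N) := by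
  obtain ⟨a, b, ha, hb, C, hC⟩ := hz
  obtain ⟨M, hM⟩ := pow_unbounded_of_one_lt C (one_lt_two : (1 : ℝ) < 2)
  have hs : Computable fun k : ℕ => k + (N + M) := Computable.id.nat_add (Computable.const _)
  refine ⟨_, _, ha.comp hs, hb.comp hs, fun k => (hC _).trans ?_⟩
  rw [div_le_div_iff₀ (by positivity) (by positivity), ← add_assoc, pow_add 2 (k + N) M, one_mul,
    mul_comm]
  gcongr

theorem isComputableReal {x : ℝ} (hx : IsComputableComplex (x : ℂ)) : IsComputableReal x := by
  obtain ⟨a, b, ha, -, h⟩ := hx.exists_approx 0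
  refine ⟨a, ha, fun k => le_trans ?_ (h k)⟩
  refine le_trans (le_of_eq ?_) (Complex.abs_re_le_norm _)
  simp

theorem ratCast (q : ℚ) : IsComputableComplex q :=
  ⟨_, _, IsComputableRat.const q, IsComputableRat.const 0, 0, fun k => by simp⟩

theorem one : IsComputableComplex 1 := by simpa using ratCast 1

theorem I : IsComputableComplex Complex.I :=
  ⟨_, _, IsComputableRat.const 0, IsComputableRat.const 1, 0, fun k => by simp⟩

theorem add {z w : ℂ} (hz : IsComputableComplex z) (hw : IsComputableComplex w) :
    IsComputableComplex (z + w) := by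
  obtain ⟨a, b, ha, hb, C, hC⟩ := hz
  obtain ⟨a', b', ha', hb', C', hC'⟩ := hw
  refine ⟨_, _, ha.add ha', hb.add hb', C + C', fun k => ?_⟩
  rw [add_div]
  refine le_trans (le_of_eq ?_) ((norm_add_le _ _).trans (add_le_add (hC k) (hC' k)))
  congr 1
  push_cast
  ring

theorem mul {z w : ℂ} (hz : IsComputableComplex z) (hw : IsComputableComplex w) :
    IsComputableComplex (z * w) := by
  obtain ⟨a, b, ha, hb, h⟩ := hz.exists_approx 0
  obtain ⟨a', b', ha', hb', h'⟩ := hw.exists_approx 0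
  refine ⟨_, _, (ha.mul ha').sub (hb.mul hb'), (ha.mul hb').add (hb.mul ha'),
    ‖w‖ + (‖z‖ + 1), fun k => ?_⟩
  have hk := h k
  have hk' := h' k
  rw [add_zero] at hk hk'
  set u := (a k : ℂ) + b k * Complex.I with hu
  set v := (a' k : ℂ) + b' k * Complex.I with hv
  have hun : ‖u‖ ≤ ‖z‖ + 1 := by
    have h1 : ‖u‖ ≤ ‖z‖ + ‖z - u‖ := by
      simpa using norm_sub_le z (z - u)
    have h2 : (1 : ℝ) / 2 ^ k ≤ 1 := by
      rw [div_le_one (by positivity)]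
      exact one_le_pow₀ one_le_two
    linarith
  have e : z * w - (((a k * a' k - b k * b' k : ℚ) : ℂ) + ((a k * b' k + b k * a' k : ℚ) : ℂ) *
      Complex.I) = w * (z - u) + u * (w - v) := by
    rw [hu, hv]
    push_cast
    linear_combination ((b k : ℂ) * b' k) * Complex.I_sq
  rw [e]
  calc ‖w * (z - u) + u * (w - v)‖ ≤ ‖w‖ * ‖z - u‖ + ‖u‖ * ‖w - v‖ :=
        (norm_add_le _ _).trans (by rw [norm_mul, norm_mul])
    _ ≤ ‖w‖ * (1 / 2 ^ k) + (‖z‖ + 1) * (1 / 2 ^ k) := by gcongr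
    _ = (‖w‖ + (‖z‖ + 1)) / 2 ^ k := by ring

theorem neg {z : ℂ} (hz : IsComputableComplex z) : IsComputableComplex (-z) := by
  simpa using (ratCast (-1)).mul hz

theorem sub {z w : ℂ} (hz : IsComputableComplex z) (hw : IsComputableComplex w) :
    IsComputableComplex (z - w) := by
  simpa [sub_eq_add_neg] using hz.add hw.neg

/-- The sum of a power series with computable rational coefficients is computable at every
computable point of its disc of convergence. -/
theorem powerSeries {c : ℕ → ℚ} (hc : IsComputableRat c) {R K : ℝ}
    (hK : ∀ n, |(c n : ℝ)| * R ^ n ≤ K) {f : ℂ → ℂ}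
    (hf : ∀ w : ℂ, ‖w‖ < R → HasSum (fun n => (c n : ℂ) * w ^ n) (f w)) {z : ℂ} (hzR : ‖z‖ < R)
    (hd : DifferentiableAt ℂ f z) (hz : IsComputableComplex z) : IsComputableComplex (f z) := by
  -- On the disc of radius ρ the terms are dominated by a geometric series of ratio ρ / R < 1.
  obtain ⟨ρ, hzρ, hρR⟩ := exists_between hzR
  have hρ0 : 0 < ρ := (norm_nonneg z).trans_lt hzρ
  have hR0 : 0 < R := hρ0.trans hρR
  have ht0 : 0 < ρ / R := by positivity
  have ht1 : ρ / R < 1 := (div_lt_one hR0).2 hρR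
  -- Differentiability bounds |f w - f z| by B |w - z| only within ε of z. The shift N keeps every
  -- approximation that close and inside the disc of radius ρ.
  obtain ⟨B, hB⟩ := hd.isBigO_sub.bound
  obtain ⟨ε, hε, hball⟩ := Metric.eventually_nhds_iff.1 hB
  obtain ⟨N, hN⟩ := exists_pow_lt_of_lt_one (lt_min hε (sub_pos.2 hzρ))
    (by norm_num : (1 / 2 : ℝ) < 1)
  -- M terms gain a factor 1/2, so k * M terms leave a tail of order 2^(-k).
  obtain ⟨M, hM⟩ := exists_pow_lt_of_lt_one (by norm_num : (0 : ℝ) < 1 / 2) ht1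
  obtain ⟨a, b, ha, hb, h⟩ := hz.exists_approx N
  obtain ⟨u, v, hu, hv, huv⟩ := (ha.comp (Computable.fst (α := ℕ) (β := ℕ))).complex_pow
    (hb.comp (Computable.fst (α := ℕ) (β := ℕ))) Computable.snd
  have hkM : Computable fun k : ℕ => k * M := Computable.id.nat_mul (Computable.const _)
  have hc' := hc.comp (Computable.snd (α := ℕ) (β := ℕ))
  refine ⟨_, _, (hc'.mul hu).sum_range hkM, (hc'.mul hv).sum_range hkM,
    |B| + K / (1 - ρ / R), fun k => ?_⟩
  set w : ℂ := (a k : ℂ) + b k * Complex.I with hw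
  have hsum : ((∑ i ∈ Finset.range (k * M), c i * u (k, i) : ℚ) : ℂ) +
      ((∑ i ∈ Finset.range (k * M), c i * v (k, i) : ℚ) : ℂ) * Complex.I =
      ∑ i ∈ Finset.range (k * M), (c i : ℂ) * w ^ i := by
    push_cast
    rw [Finset.sum_mul, ← Finset.sum_add_distrib]
    refine Finset.sum_congr rfl fun i _ => ?_
    rw [hw, ← huv (k, i)]
    ring
  have hzw := h k
  have hsmall : (1 : ℝ) / 2 ^ (k + N) ≤ (1 / 2) ^ N := by
    rw [one_div_pow]
    gcongr
    · norm_num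
    · omega
  have hwε : ‖w - z‖ < ε := by
    rw [norm_sub_rev]
    exact (hzw.trans hsmall).trans_lt (hN.trans_le (min_le_left _ _))
  have hwρ : ‖w‖ < ρ := by
    have h1 : ‖z - w‖ < ρ - ‖z‖ := (hzw.trans hsmall).trans_lt (hN.trans_le (min_le_right _ _))
    have h2 : ‖w‖ ≤ ‖z‖ + ‖z - w‖ := by simpa using norm_sub_le z (z - w)
    linarith
  have hK0 : 0 ≤ K := le_trans (by positivity) (hK 0)
  have h1 : ‖f z - f w‖ ≤ |B| / 2 ^ k := by
    rw [norm_sub_rev]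
    calc ‖f w - f z‖ ≤ B * ‖w - z‖ := hball (by rwa [dist_eq_norm])
      _ ≤ |B| * ‖z - w‖ := by
        rw [norm_sub_rev w z]
        exact mul_le_mul_of_nonneg_right (le_abs_self _) (norm_nonneg _)
      _ ≤ |B| * (1 / 2 ^ k) := by
        refine mul_le_mul_of_nonneg_left (hzw.trans ?_) (abs_nonneg _)
        gcongr
        · norm_num
        · omega
      _ = |B| / 2 ^ k := by ring
  have hgeom : ∀ n, ‖(c n : ℂ) * w ^ n‖ ≤ K * (ρ / R) ^ n := fun n => by
    rw [norm_mul, norm_pow]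
    calc ‖(c n : ℂ)‖ * ‖w‖ ^ n ≤ |(c n : ℝ)| * ρ ^ n := by
          have : ‖(c n : ℂ)‖ = |(c n : ℝ)| := by
            rw [← Complex.ofReal_ratCast, Complex.norm_real, Real.norm_eq_abs]
          rw [this]
          gcongr
      _ = |(c n : ℝ)| * R ^ n * (ρ / R) ^ n := by
          rw [div_pow]
          field_simp
      _ ≤ K * (ρ / R) ^ n := by
          gcongr
          exact hK n
  have h2 := norm_sub_le_of_geometric_bound_of_hasSum ht1 hgeom (hf w (hwρ.trans hρR)) (k * M)
  rw [norm_sub_rev] at h2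
  have h3 : K * (ρ / R) ^ (k * M) / (1 - ρ / R) ≤ K / (1 - ρ / R) / 2 ^ k := by
    have h4 : (ρ / R) ^ (k * M) ≤ 1 / 2 ^ k := by
      rw [mul_comm, pow_mul, ← one_div_pow]
      gcongr
    have h5 : 0 < 1 - ρ / R := sub_pos.2 ht1
    calc K * (ρ / R) ^ (k * M) / (1 - ρ / R) ≤ K * (1 / 2 ^ k) / (1 - ρ / R) := by gcongr
      _ = _ := by ring
  rw [hsum, add_div]
  calc _ = ‖(f z - f w) + (f w - ∑ i ∈ Finset.range (k * M), (c i : ℂ) * w ^ i)‖ := by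
        congr 1
        ring
    _ ≤ _ := (norm_add_le _ _).trans (add_le_add h1 (h2.trans h3))

theorem exp {z : ℂ} (hz : IsComputableComplex z) : IsComputableComplex (Complex.exp z) := by
  have hc : IsComputableRat fun n : ℕ => (n.factorial : ℚ)⁻¹ :=
    .inv_natCast (Computable.factorial Computable.id) fun n => n.factorial_ne_zero
  refine powerSeries hc (R := ‖z‖ + 1) (K := Real.exp (‖z‖ + 1)) (fun n => ?_) (fun w _ => ?_)
    (lt_add_one _) Complex.differentiable_exp.differentiableAt hz
  · have h := Real.pow_div_factorial_le_exp (x := ‖z‖ + 1) (by positivity) n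
    rw [abs_of_nonneg (by positivity)]
    push_cast
    rwa [mul_comm, ← div_eq_mul_inv]
  · have h := NormedSpace.expSeries_div_hasSum_exp w
    rw [← Complex.exp_eq_exp_ℂ] at h
    simpa [div_eq_inv_mul] using h

theorem log_one_sub {z : ℂ} (hz : IsComputableComplex z) (h1 : ‖z‖ < 1) :
    IsComputableComplex (Complex.log (1 - z)) := by
  have hc : IsComputableRat fun n : ℕ => ((n : ℚ))⁻¹ * (if n = 0 then 0 else 1) := by
    -- With truncated subtraction this is n² for n ≥ 1 and 1 for n = 0. It never vanishes, and n
    -- divided by it is 1/n, or 0 at n = 0.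
    have hs : Computable fun n : ℕ => n * n + (1 - n) :=
      (Computable.id.nat_mul Computable.id).nat_add ((Computable.const 1).nat_sub Computable.id)
    refine ((IsComputableRat.natCast Computable.id).mul
      (IsComputableRat.inv_natCast hs fun n => ?_)).of_eq fun n => ?_
    · rcases n with _ | n
      · simp
      · positivity
    · rcases n with _ | n
      · simp
      · have : (n : ℚ) + 1 ≠ 0 := by positivity
        simp
        field_simp
  have key := powerSeries hc (R := 1) (K := 1) (f := fun w => -Complex.log (1 - w)) (fun n => ?_)
    (fun w hw => ?_) h1 ?_ hz
  · simpa using key.neg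
  · rcases n with _ | n
    · simp
    · have : (1 : ℝ) ≤ (n : ℝ) + 1 := by linarith [n.cast_nonneg (α := ℝ)]
      rw [abs_of_nonneg (by positivity)]
      simpa using inv_le_one_of_one_le₀ this
  · convert Complex.hasSum_taylorSeries_neg_log hw using 2 with n
    rcases n with _ | n
    · simp
    · push_cast
      simp [div_eq_mul_inv, mul_comm]
  · refine ((differentiableAt_const _).sub differentiableAt_id).clog ?_ |>.neg
    refine Complex.mem_slitPlane_of_norm_lt_one (z := -z) (by simpa using h1) |> fun h => ?_
    simpa [sub_eq_add_neg] using h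

theorem log_of_norm_lt {z : ℂ} (hz : IsComputableComplex z) (h1 : ‖1 - z‖ < 1) :
    IsComputableComplex (Complex.log z) := by
  simpa using (one.sub hz).log_one_sub h1

theorem log_two : IsComputableComplex (Real.log 2 : ℂ) := by
  have h : IsComputableComplex (((1 / 2 : ℚ) : ℂ)) := ratCast _
  have := (h.log_of_norm_lt (by norm_num)).neg
  convert this using 1
  have e : (((1 / 2 : ℚ)) : ℂ) = (((2 : ℝ)⁻¹ : ℝ) : ℂ) := by push_cast; norm_num
  rw [e, ← Complex.ofReal_log (by norm_num), Real.log_inv]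
  simp

/-- For t > 0 we have |1 - tz|² = 1 - 2t Re z + t²|z|², which is below 1 once t|z|² < Re z. Taking t
= 2^(-m) moves z into the disc of the series, and log z = log (tz) + m log 2. -/
theorem log_of_re_pos {z : ℂ} (hz : IsComputableComplex z) (h0 : 0 < z.re) :
    IsComputableComplex (Complex.log z) := by
  obtain ⟨m, hm⟩ := pow_unbounded_of_one_lt (Complex.normSq z / z.re) (one_lt_two : (1 : ℝ) < 2)
  rw [div_lt_iff₀ h0] at hm
  have hz0 : z ≠ 0 := by rintro rfl; simp at h0
  have hp : (0 : ℝ) < ((2 : ℝ) ^ m)⁻¹ := by positivity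
  have hw : IsComputableComplex ((((2 : ℝ) ^ m)⁻¹ : ℝ) * z) := by
    simpa using (ratCast ((2 ^ m)⁻¹)).mul hz
  have hlog := Complex.log_ofReal_mul hp hz0
  have hlt : ‖1 - (((2 : ℝ) ^ m)⁻¹ : ℝ) * z‖ < 1 := by
    rw [← sq_lt_one_iff₀ (norm_nonneg _), ← Complex.normSq_eq_norm_sq, Complex.normSq_apply]
    rw [Complex.normSq_apply] at hm
    set t := ((2 : ℝ) ^ m)⁻¹ with ht
    have ht2 : t * 2 ^ m = 1 := inv_mul_cancel₀ (by positivity)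
    have h3 : t * (z.re * z.re + z.im * z.im) < z.re := by
      calc _ < t * (2 ^ m * z.re) := by gcongr
        _ = z.re := by rw [← mul_assoc, ht2, one_mul]
    simp only [Complex.sub_re, Complex.one_re, Complex.re_ofReal_mul, Complex.sub_im,
      Complex.one_im, Complex.im_ofReal_mul]
    nlinarith [mul_lt_mul_of_pos_left h3 hp, mul_pos hp h0]
  have h2 := hw.log_of_norm_lt hlt
  rw [hlog, Real.log_inv, Real.log_pow] at h2
  have h3 := h2.add ((ratCast m).mul log_two)
  convert h3 using 1
  push_cast
  ring

/-- Since (1 + i)² = 2i, twice log (1 + i) equals log 2 + iπ/2. -/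
theorem pi : IsComputableComplex (Real.pi : ℂ) := by
  have hre : 0 < (1 + Complex.I).re := by simp
  have h0 : (1 + Complex.I) ≠ 0 := by
    intro h
    simp [h] at hre
  have harg := abs_lt.1 (Complex.abs_arg_lt_pi_div_two_iff.2 (Or.inl hre))
  have h1 := (one.add I).log_of_re_pos hre
  have e1 := Complex.log_mul h0 h0 ⟨by linarith, by linarith⟩
  have e2 : (1 + Complex.I) * (1 + Complex.I) = (2 : ℝ) * Complex.I := by
    push_cast
    linear_combination Complex.I_sq
  rw [e2, Complex.log_ofReal_mul two_pos Complex.I_ne_zero, Complex.log_I] at e1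
  convert (((h1.add h1).sub log_two).mul I).mul (ratCast (-2)) using 1
  rw [← e1]
  push_cast
  linear_combination (Real.pi : ℂ) * Complex.I_sq

/-- Multiplying by i, -1 or -i takes z into the right half-plane and changes the logarithm by a
computable constant. The sign of Im z cannot be decided from approximations, but z is fixed and only
the existence of an algorithm is claimed, so the branch cut causes no trouble. -/
theorem log {z : ℂ} (hz : IsComputableComplex z) (h0 : z ≠ 0) :
    IsComputableComplex (Complex.log z) := by
  have hpi := Real.pi_pos
  have hpi2 : IsComputableComplex (Real.pi / 2 * Complex.I) := by
    convert (pi.mul (ratCast (1 / 2))).mul I using 1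
    push_cast
    ring
  rcases lt_trichotomy z.im 0 with him | him | him
  · have hre : 0 < (Complex.I * z).re := by simpa using him
    have hw0 : Complex.I * z ≠ 0 := mul_ne_zero Complex.I_ne_zero h0
    have harg := abs_lt.1 (Complex.abs_arg_lt_pi_div_two_iff.2 (Or.inl hre))
    have e := Complex.log_mul (neg_ne_zero.2 Complex.I_ne_zero) hw0 (by
      rw [Complex.arg_neg_I]
      exact ⟨by linarith, by linarith⟩)
    have e2 : -Complex.I * (Complex.I * z) = z := by linear_combination (-z) * Complex.I_sq
    rw [e2, Complex.log_neg_I] at e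
    rw [e]
    convert hpi2.neg.add ((I.mul hz).log_of_re_pos hre) using 2
    ring
  · rcases lt_or_ge 0 z.re with hre | hre
    · exact hz.log_of_re_pos hre
    · have hre' : z.re < 0 := lt_of_le_of_ne hre fun h => h0 (Complex.ext h him)
      have hw : 0 < (-z).re := by simpa using hre'
      have harg : (-z).arg = 0 := Complex.arg_eq_zero_iff.2 ⟨hw.le, by simp [him]⟩
      have e := Complex.log_mul (neg_ne_zero.2 one_ne_zero) (neg_ne_zero.2 h0) (by
        rw [Complex.arg_neg_one, harg, add_zero]
        exact ⟨by linarith, le_rfl⟩)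
      rw [neg_mul_neg, one_mul, Complex.log_neg_one] at e
      rw [e]
      exact (pi.mul I).add (hz.neg.log_of_re_pos hw)
  · have hre : 0 < (-Complex.I * z).re := by simpa using him
    have hw0 : -Complex.I * z ≠ 0 := mul_ne_zero (neg_ne_zero.2 Complex.I_ne_zero) h0
    have harg := abs_lt.1 (Complex.abs_arg_lt_pi_div_two_iff.2 (Or.inl hre))
    have e := Complex.log_mul Complex.I_ne_zero hw0 (by
      rw [Complex.arg_I]
      exact ⟨by linarith, by linarith⟩)
    have e2 : Complex.I * (-Complex.I * z) = z := by linear_combination (-z) * Complex.I_sq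
    rw [e2, Complex.log_I] at e
    rw [e]
    exact hpi2.add ((I.neg.mul hz).log_of_re_pos hre)

end IsComputableComplex

/-! ### EML values are computable -/

theorem EMLExpr.isComputableComplex_value : ∀ φ : EMLExpr, φ.Defined →
    IsComputableComplex φ.value
  | .one, _ => IsComputableComplex.one
  | .E α β, ⟨hα, hβ, h0⟩ =>
    (isComputableComplex_value α hα).exp.sub ((isComputableComplex_value β hβ).log h0)

theorem notMem_EML_of_not_isComputableReal {x : ℝ} (hx : ¬ IsComputableReal x) :
    (x : ℂ) ∉ EML := by
  rintro ⟨φ, hφ, h⟩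
  exact hx (h ▸ φ.isComputableComplex_value hφ).isComputableReal

/-! ### Deciding an enumerable set from its weighted sum -/

theorem ComputablePred.comp {α β : Type*} [Primcodable α] [Primcodable β] {p : β → Prop}
    (hp : ComputablePred p) {f : α → β} (hf : Computable f) : ComputablePred fun a => p (f a) := by
  obtain ⟨b, hb, rfl⟩ := ComputablePred.computable_iff.1 hp
  exact ComputablePred.computable_iff.2 ⟨_, hb.comp hf, rfl⟩

theorem REPred.comp {α β : Type*} [Primcodable α] [Primcodable β] {p : β → Prop}
    (hp : REPred p) {f : α → β} (hf : Computable f) : REPred fun a => p (f a) :=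
  Partrec.comp hp hf

/-- A recursively enumerable predicate is the increasing union of a computable sequence of
decidable predicates. -/
theorem REPred.exists_stages {α : Type*} [Primcodable α] {p : α → Prop} (hp : REPred p) :
    ∃ D : α × ℕ → Bool, Computable D ∧ (∀ a s t, s ≤ t → D (a, s) = true → D (a, t) = true) ∧
      ∀ a, p a ↔ ∃ s, D (a, s) = true := by
  obtain ⟨c, hc⟩ := Nat.Partrec.Code.exists_code.1 hp
  refine ⟨fun x => (Nat.Partrec.Code.evaln x.2 c (Encodable.encode x.1)).isSome, ?_, ?_, ?_⟩
  · exact (Primrec.option_isSome.comp (Nat.Partrec.Code.primrec_evaln.comp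
      ((Primrec.snd.pair (Primrec.const c)).pair (Primrec.encode.comp Primrec.fst)))).to_comp
  · intro a s t hst h
    obtain ⟨y, hy⟩ := Option.isSome_iff_exists.1 h
    exact Option.isSome_iff_exists.2 ⟨y, Nat.Partrec.Code.evaln_mono hst hy⟩
  · intro a
    have h1 : p a ↔ (c.eval (Encodable.encode a)).Dom := by
      rw [hc]
      simp [Part.assert, Part.bind]
    rw [h1, Part.dom_iff_mem]
    simp only [Nat.Partrec.Code.evaln_complete, Option.isSome_iff_exists]
    exact exists_comm

/-- If `P` is recursively enumerable and the sum of the weights `2^(-l n)` over all `n`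
satisfying `P` is a computable real, then `P` is decidable. -/
theorem computablePred_of_hasSum {P : ℕ → Prop} (hP : REPred P) {l : ℕ → ℕ} (hl : Computable l)
    {x : ℝ} (hx : HasSum ({n | P n}.indicator fun n => (1 : ℝ) / 2 ^ l n) x)
    (hxc : IsComputableReal x) : ComputablePred P := by
  obtain ⟨D, hD, hmono, hPD⟩ := hP.exists_stages
  obtain ⟨r, hr, hrx⟩ := hxc
  set W : ℕ → ℝ := {n | P n}.indicator fun n => (1 : ℝ) / 2 ^ l n with hW
  have hW0 : ∀ n, 0 ≤ W n := fun n => Set.indicator_nonneg (fun _ _ => by positivity) n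
  have hWP : ∀ n, P n → W n = 1 / 2 ^ l n := fun n hn => Set.indicator_of_mem hn _
  -- The weight found by stage s among the indices below s: computable approximations from below to
  -- x.
  let q : ℕ → ℚ := fun s => ∑ i ∈ Finset.range s, bif D (i, s) then (1 : ℚ) / 2 ^ l i else 0
  have hq : IsComputableRat q := by
    have h : IsComputableRat fun y : ℕ × ℕ => bif D (y.2, y.1) then (1 : ℚ) / 2 ^ l y.2 else 0 :=
      .cond (hD.comp (Computable.snd.pair Computable.fst))
        (.one_div_two_pow (hl.comp Computable.snd)) (.const 0)
    exact h.sum_range Computable.id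
  have hqle : ∀ s i, ((bif D (i, s) then (1 : ℚ) / 2 ^ l i else 0 : ℚ) : ℝ) ≤ W i := by
    intro s i
    cases h : D (i, s)
    · simpa using hW0 i
    · rw [hWP i ((hPD i).2 ⟨s, h⟩)]
      simp
  -- An element not yet enumerated still owes its whole weight to the sum.
  have hlow : ∀ n s, P n → D (n, s) = false → (1 : ℝ) / 2 ^ l n ≤ x - q s := by
    intro n s hn hns
    let t := Finset.range s ∪ {n}
    have h1 : ∑ i ∈ t, W i ≤ x := sum_le_hasSum _ (fun i _ => hW0 i) hx
    have h2 : (q s : ℝ) ≤ ∑ i ∈ (Finset.range s).erase n, W i := by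
      simp only [q]
      push_cast
      have h3 : ∑ i ∈ Finset.range s, ((bif D (i, s) then (1 : ℚ) / 2 ^ l i else 0 : ℚ) : ℝ) =
          ∑ i ∈ (Finset.range s).erase n,
            ((bif D (i, s) then (1 : ℚ) / 2 ^ l i else 0 : ℚ) : ℝ) := by
        rw [Finset.sum_erase]
        simp [hns]
      rw [h3]
      exact Finset.sum_le_sum fun i _ => hqle s i
    have h4 : t = insert n ((Finset.range s).erase n) := by
      ext i
      by_cases hi : i = n <;> simp [t, hi]
    rw [h4, Finset.sum_insert (Finset.notMem_erase _ _), hWP n hn] at h1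
    linarith
  have hhigh : ∀ ε > 0, ∃ s, x - q s < ε := by
    intro ε hε
    obtain ⟨S, hS⟩ := ((hx.tendsto_sum_nat.eventually (lt_mem_nhds (sub_lt_self x hε)))).exists
    have hst : ∀ i, ∃ s, P i → D (i, s) = true := fun i => by
      by_cases h : P i
      · obtain ⟨s, hs⟩ := (hPD i).1 h
        exact ⟨s, fun _ => hs⟩
      · exact ⟨0, fun h' => absurd h' h⟩
    choose σ hσ using hst
    refine ⟨S + (Finset.range S).sup σ, ?_⟩
    set s := S + (Finset.range S).sup σ
    have h1 : ∑ i ∈ Finset.range S, W i ≤ q s := by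
      simp only [q]
      push_cast
      calc ∑ i ∈ Finset.range S, W i
          ≤ ∑ i ∈ Finset.range S, ((bif D (i, s) then (1 : ℚ) / 2 ^ l i else 0 : ℚ) : ℝ) := by
            refine Finset.sum_le_sum fun i hi => ?_
            by_cases h : P i
            · have : D (i, s) = true :=
                hmono i (σ i) s ((Finset.le_sup hi).trans (Nat.le_add_left _ _)) (hσ i h)
              simp [this, hWP i h]
            · have : W i = 0 := Set.indicator_of_notMem h _
              rw [this]
              cases D (i, s) <;> simp
        _ ≤ _ := by
            refine Finset.sum_le_sum_of_subset_of_nonneg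
              (Finset.range_mono (Nat.le_add_right _ _)) fun i _ _ => ?_
            cases D (i, s) <;> simp
    linarith
  -- In units of 2^(-l n): a stage with x - q s < 1/4 passes this test, as r errs by at most 1/4.
  -- Conversely, passing forces x - q s ≤ 3/4 < 1, so by `hlow` a member n has already appeared.
  have hex : ∀ n, ∃ s, r (l n + 2) - q s ≤ 1 / 2 ^ (l n + 1) := fun n => by
    obtain ⟨s, hs⟩ := hhigh (1 / 2 ^ (l n + 2)) (by positivity)
    refine ⟨s, ?_⟩
    have h1 := (abs_le.1 (hrx (l n + 2))).1
    have h2 : (r (l n + 2) : ℝ) - q s ≤ 1 / 2 ^ (l n + 1) := by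
      have : (1 : ℝ) / 2 ^ (l n + 1) = 2 * (1 / 2 ^ (l n + 2)) := by
        field_simp
        ring
      linarith
    refine (Rat.cast_le (K := ℝ)).1 ?_
    push_cast
    exact h2
  have hcomp : ComputablePred fun y : ℕ × ℕ => r (l y.1 + 2) - q y.2 ≤ 1 / 2 ^ (l y.1 + 1) :=
    Computable.computablePred (((hr.comp ((hl.comp Computable.fst).nat_add
      (Computable.const 2))).sub (hq.comp Computable.snd)).decide_le
        (.one_div_two_pow ((hl.comp Computable.fst).nat_add (Computable.const 1))))
  refine ComputablePred.computable_iff.2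
    ⟨_, hD.comp (Computable.id.pair (Computable.find hcomp hex)), funext fun n => propext ?_⟩
  refine ⟨fun hn => ?_, fun hn => (hPD n).2 ⟨_, hn⟩⟩
  by_contra hns
  have h1 := hlow n _ hn (Bool.eq_false_iff.2 hns)
  have h2 : (r (l n + 2) : ℝ) - q (Nat.find (hex n)) ≤ 1 / 2 ^ (l n + 1) := by
    have h := (Rat.cast_le (K := ℝ)).2 (Nat.find_spec (hex n))
    push_cast at h
    exact h
  have h3 := (abs_le.1 (hrx (l n + 2))).2
  have h4 : (1 : ℝ) / 2 ^ l n = 4 * (1 / 2 ^ (l n + 2)) := by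
    field_simp
    ring
  have h5 : (1 : ℝ) / 2 ^ (l n + 1) = 2 * (1 / 2 ^ (l n + 2)) := by
    field_simp
    ring
  have h6 : (0 : ℝ) < 1 / 2 ^ (l n + 2) := by positivity
  linarith

/-! ### Binary expansions of the halting sets -/

theorem summable_indicator_one_div_two_pow (S : Set ℕ) :
    Summable (S.indicator fun n => (1 : ℝ) / 2 ^ (n + 1)) := by
  refine Summable.indicator ?_ S
  have h : Summable fun n : ℕ => (1 / 2 : ℝ) ^ n := summable_geometric_two
  simpa [one_div_pow] using (summable_nat_add_iff 1).2 h

theorem computablePred_of_isComputableReal_binaryReal {A : Set ℕ} (hA : REPred (· ∈ A))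
    (h : IsComputableReal (binaryReal A)) : ComputablePred (· ∈ A) := by
  have hs : HasSum ({n | n + 1 ∈ A}.indicator fun n => (1 : ℝ) / 2 ^ (n + 1)) (binaryReal A) := by
    have e : binaryReal A = ∑' n, {n | n + 1 ∈ A}.indicator (fun n => (1 : ℝ) / 2 ^ (n + 1)) n := by
      refine tsum_congr fun n => ?_
      by_cases hn : n + 1 ∈ A <;> simp [hn]
    rw [e]
    exact (summable_indicator_one_div_two_pow _).hasSum
  have hsucc : Computable fun n : ℕ => n + 1 := Computable.succ
  obtain ⟨b, hb, hbA⟩ := ComputablePred.computable_iff.1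
    (computablePred_of_hasSum (hA.comp hsucc) hsucc hs h)
  classical
  -- The expansion records only positive integers; membership of 0 is a single bit, hard-wired into
  -- the algorithm.
  refine ComputablePred.computable_iff.2 ⟨_, Computable.nat_casesOn (h := fun _ n => b n)
    Computable.id (Computable.const (decide (0 ∈ A))) (hb.comp Computable.snd).to₂,
    funext fun n => ?_⟩
  cases n with
  | zero => simp
  | succ n => exact congrFun hbA n

theorem partrec_program : Partrec₂ program :=
  Nat.Partrec.Code.eval_part.comp
    ((Computable.ofNat Nat.Partrec.Code).comp Computable.fst) Computable.snd

/-- Diagonal argument: a decision procedure would yield a program halting exactly on the numbers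
outside the set, contradictory on its own number. -/
theorem not_computablePred_selfHaltingSet : ¬ ComputablePred (· ∈ selfHaltingSet) := by
  intro h
  obtain ⟨b, hb, hbS⟩ := ComputablePred.computable_iff.1 h
  have hp : Partrec fun n : ℕ => bif b n then Part.none else Part.some 0 :=
    Partrec.cond hb Partrec.none (Computable.const 0).partrec
  obtain ⟨c, hc⟩ := Nat.Partrec.Code.exists_code.1 (Partrec.nat_iff.1 hp)
  have h1 : program (Encodable.encode c) (Encodable.encode c) =
      bif b (Encodable.encode c) then Part.none else Part.some 0 := by
    rw [program, Denumerable.ofNat_encode, hc]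
  have h2 : (program (Encodable.encode c) (Encodable.encode c)).Dom ↔
      b (Encodable.encode c) = true := iff_of_eq (congrFun hbS (Encodable.encode c))
  rw [h1] at h2
  cases hbc : b (Encodable.encode c) <;> simp [hbc] at h2

theorem not_isComputableReal_binaryReal_selfHaltingSet :
    ¬ IsComputableReal (binaryReal selfHaltingSet) := fun h =>
  not_computablePred_selfHaltingSet (computablePred_of_isComputableReal_binaryReal
    (partrec_program.comp Computable.id Computable.id).dom_re h)

theorem not_isComputableReal_binaryReal_haltingSet :
    ¬ IsComputableReal (binaryReal haltingSet) := fun h => by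
  have hd := computablePred_of_isComputableReal_binaryReal (A := haltingSet)
    (partrec_program.comp (Computable.fst.comp Computable.unpair)
      (Computable.snd.comp Computable.unpair)).dom_re h
  refine not_computablePred_selfHaltingSet
    ((hd.comp ((Primrec₂.natPair.to_comp).comp Computable.id Computable.id)).of_eq fun e => ?_)
  simp [haltingSet, selfHaltingSet]

theorem not_isComputableReal_binaryReal_inputHaltingSet (m : ℕ) :
    ¬ IsComputableReal (binaryReal (inputHaltingSet m)) := fun h => by
  have hd := computablePred_of_isComputableReal_binaryReal (A := inputHaltingSet m)
    (partrec_program.comp Computable.id (Computable.const m)).dom_re h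
  refine ComputablePred.halting_problem m ((hd.comp Computable.encode).of_eq fun c => ?_)
  simp [inputHaltingSet, program]

/-! ### Specker sequences -/

theorem rePred_mem_range {a : ℕ → ℕ} (ha : Computable a) : REPred (· ∈ Set.range a) := by
  have h : Partrec₂ fun (m n : ℕ) => Part.some (decide (a n = m)) :=
    (Primrec.eq.decide.to_comp.comp (ha.comp Computable.snd) Computable.fst).partrec
  refine (Partrec.rfind h).dom_re.of_eq fun m => ?_
  exact Nat.rfind_dom.trans (by simp)

/-- By injectivity each element of the range contributes once, so the supremum is the weighted sum
over the range, and its computability would decide the range. -/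
theorem isSpeckerSequence_of_injective {a : ℕ → ℕ} (ha : Computable a)
    (hinj : Function.Injective a) (hdec : ¬ ComputablePred fun m : ℕ => m ∈ Set.range a) :
    IsSpeckerSequence fun n => ∑ i ∈ Finset.range n, (1 : ℚ) / 2 ^ (a i + 1) := by
  have hsucc : Computable fun n : ℕ => n + 1 := Computable.succ
  obtain ⟨x, hs⟩ := summable_indicator_one_div_two_pow (Set.range a)
  have hmono : Monotone fun n => ∑ i ∈ Finset.range n, (1 : ℚ) / 2 ^ (a i + 1) :=
    fun m n hmn => Finset.sum_le_sum_of_subset_of_nonneg (Finset.range_mono hmn)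
      fun i _ _ => by positivity
  have hcast : ∀ n, ((∑ i ∈ Finset.range n, (1 : ℚ) / 2 ^ (a i + 1) : ℚ) : ℝ) =
      ∑ i ∈ Finset.range n, (1 : ℝ) / 2 ^ (a i + 1) := fun n => by push_cast; rfl
  have hs' : HasSum (fun i => (1 : ℝ) / 2 ^ (a i + 1)) x :=
    ((hinj.hasSum_iff fun n hn => Set.indicator_of_notMem hn _).2 hs).congr_fun
      fun i => by simp
  have hbdd : BddAbove (Set.range fun n =>
      ((∑ i ∈ Finset.range n, (1 : ℚ) / 2 ^ (a i + 1) : ℚ) : ℝ)) := by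
    refine ⟨x, ?_⟩
    rintro _ ⟨n, rfl⟩
    simp only [hcast]
    exact sum_le_hasSum _ (fun i _ => by positivity) hs'
  refine ⟨?_, hmono, hbdd, fun h => hdec ?_⟩
  · have h : IsComputableRat fun y : ℕ × ℕ => (1 : ℚ) / 2 ^ (a y.2 + 1) :=
      .one_div_two_pow (hsucc.comp (ha.comp Computable.snd))
    exact h.sum_range Computable.id
  · have hsup := tendsto_nhds_unique
      (tendsto_atTop_ciSup (fun m n hmn => Rat.cast_le.2 (hmono hmn)) hbdd)
      (by simpa only [hcast] using hs'.tendsto_sum_nat)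
    rw [hsup] at h
    exact computablePred_of_hasSum (rePred_mem_range ha) hsucc hs h

/-! ### Chaitin's halting probabilities -/

/-- A prefix-free set without the empty word is uniquely decodable, so Kraft–McMillan bounds all
finite sums by 1; one with the empty word is a singleton. Without summability the `tsum` defining
`chaitinOmega` would be the default 0. -/
theorem summable_of_prefixFree {S : Set (List Bool)} (hS : ∀ p ∈ S, ∀ q ∈ S, p <+: q → p = q) :
    Summable fun p : S => (1 : ℝ) / 2 ^ p.1.length := by
  by_cases hnil : [] ∈ S
  · have : Subsingleton S := ⟨fun p q => Subtype.ext
      ((hS _ hnil _ p.2 List.nil_prefix).symm.trans (hS _ hnil _ q.2 List.nil_prefix))⟩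
    have := Fintype.ofFinite S
    exact (hasSum_fintype _).summable
  have hud : InformationTheory.UniquelyDecodable S := by
    intro L₁
    induction L₁ with
    | nil =>
      intro L₂ _ h₂ h
      cases L₂ with
      | nil => rfl
      | cons v L =>
        have hv : v = [] := by
          have h' := h.symm
          rw [List.flatten_nil, List.flatten_cons, List.append_eq_nil_iff] at h'
          exact h'.1
        exact absurd (hv ▸ h₂ v (by simp)) hnil
    | cons w L₁ ih =>
      intro L₂ h₁ h₂ h
      cases L₂ with
      | nil =>
        have hw : w = [] := by
          rw [List.flatten_nil, List.flatten_cons, List.append_eq_nil_iff] at h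
          exact h.1
        exact absurd (hw ▸ h₁ w (by simp)) hnil
      | cons v L₂ =>
        rw [List.flatten_cons, List.flatten_cons] at h
        have hwS := h₁ w (by simp)
        have hvS := h₂ v (by simp)
        have hvw : w = v := by
          rcases List.prefix_or_prefix_of_prefix (List.prefix_append w L₁.flatten)
            (h ▸ List.prefix_append v L₂.flatten) with h' | h'
          · exact hS _ hwS _ hvS h'
          · exact (hS _ hvS _ hwS h').symm
        subst hvw
        rw [ih L₂ (fun u hu => h₁ u (by simp [hu])) (fun u hu => h₂ u (by simp [hu]))
          (List.append_cancel_left h)]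
  refine summable_of_sum_le (c := 1) (fun p => by positivity) fun F => ?_
  have h := InformationTheory.kraft_mcmillan_inequality
    (S := F.map (Function.Embedding.subtype _)) fun L₁ L₂ h₁ h₂ => hud L₁ L₂
      (fun w hw => by
        obtain ⟨p, -, rfl⟩ := Finset.mem_map.1 (h₁ w hw)
        exact p.2)
      (fun w hw => by
        obtain ⟨p, -, rfl⟩ := Finset.mem_map.1 (h₂ w hw)
        exact p.2)
  rw [Finset.sum_map] at h
  simpa [one_div_pow] using h

theorem computablePred_dom_of_isComputableReal_chaitinOmega {U : List Bool →. List Bool}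
    (hU : IsPrefixFreeMachine U) (h : IsComputableReal (chaitinOmega U)) :
    ComputablePred fun p => (U p).Dom := by
  let P : ℕ → Prop := fun n => ∃ p : List Bool, Encodable.encode p = n ∧ (U p).Dom
  have hP : REPred P := by
    refine (Partrec.nat_iff.2 (Partrec.bind_decode₂_iff.1 hU.1)).dom_re.of_eq fun n => ?_
    simp only [P, Part.dom_iff_mem, Part.mem_bind_iff, Part.mem_ofOption, Part.mem_map_iff,
      Encodable.mem_decode₂]
    constructor
    · rintro ⟨_, p, hp, y, hy, -⟩
      exact ⟨p, hp, y, hy⟩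
    · rintro ⟨p, hp, y, hy⟩
      exact ⟨_, p, hp, y, hy, rfl⟩
  have hPe : ∀ p, P (Encodable.encode p) ↔ (U p).Dom := fun p =>
    ⟨fun ⟨_, he, hd⟩ => Encodable.encode_injective he ▸ hd, fun hd => ⟨p, rfl, hd⟩⟩
  -- The default `[]` is harmless: P fails wherever decoding fails.
  let l : ℕ → ℕ := fun n => ((Encodable.decode n : Option (List Bool)).getD []).length
  have hl : Computable l :=
    Computable.list_length.comp (Computable.option_getD Computable.decode (Computable.const []))
  have hsum : Summable fun p : {p | (U p).Dom} => (1 : ℝ) / 2 ^ p.1.length :=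
    summable_of_prefixFree fun p hp q hq => hU.2 p q hp hq
  let e : {p : List Bool // (U p).Dom} → ℕ := fun p => Encodable.encode p.1
  have he : Function.Injective e := fun p q hpq => Subtype.ext (Encodable.encode_injective hpq)
  have hx : HasSum ({n | P n}.indicator fun n => (1 : ℝ) / 2 ^ l n) (chaitinOmega U) := by
    refine (he.hasSum_iff fun n hn => Set.indicator_of_notMem (fun hPn => hn ?_) _).1
      (hsum.hasSum.congr_fun fun p => ?_)
    · obtain ⟨p, hp, hd⟩ := hPn
      exact ⟨⟨p, hd⟩, hp⟩
    · have hp : e p ∈ {n | P n} := (hPe p.1).2 p.2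
      rw [Function.comp_apply, Set.indicator_of_mem hp]
      simp [e, l]
  exact ((computablePred_of_hasSum hP hl hx h).comp Computable.encode).of_eq hPe

/-- The string `1 … 1 0` with `e` ones. -/
def unaryString (e : ℕ) : List Bool := List.replicate e true ++ [false]

theorem computable_unaryString : Computable unaryString := by
  refine (Computable.nat_rec (h := fun _ y => true :: y.2) Computable.id
    (Computable.const [false]) ?_).of_eq fun e => ?_
  · exact (Computable.list_cons.comp (Computable.const true)
      (Computable.snd.comp Computable.snd)).to₂
  · simp only [id]
    induction e with
    | zero => rfl
    | succ e ih => rw [unaryString, List.replicate_succ, List.cons_append, ← unaryString, ← ih]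

theorem length_unaryString (e : ℕ) : (unaryString e).length = e + 1 := by simp [unaryString]

theorem eq_of_unaryString_prefix {e f : ℕ} (h : unaryString e <+: unaryString f) : e = f := by
  induction e generalizing f with
  | zero => cases f <;> simp [unaryString, List.replicate_succ] at h ⊢
  | succ e ih =>
    cases f with
    | zero => simp [unaryString, List.replicate_succ] at h
    | succ f =>
      simp only [unaryString, List.replicate_succ, List.cons_append, List.cons_prefix_cons] at h
      rw [ih h.2]

/-- A prefix-free machine whose domain is the diagonal halting set in unary coding. -/
def selfHaltingMachine (p : List Bool) : Part (List Bool) :=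
  bif decide (unaryString (p.length - 1) = p) then
    (program (p.length - 1) (p.length - 1)).map fun _ => []
  else Part.none

theorem isPrefixFreeMachine_selfHaltingMachine : IsPrefixFreeMachine selfHaltingMachine := by
  have hl : Computable fun p : List Bool => p.length - 1 :=
    Computable.list_length.nat_sub (Computable.const 1)
  refine ⟨Partrec.cond (Primrec.eq.decide.to_comp.comp (computable_unaryString.comp hl)
    Computable.id) ((partrec_program.comp hl hl).map (Computable.const []).to₂) Partrec.none, ?_⟩
  -- The length leaves only one candidate for e. The truncated subtraction is harmless at `[]`,
  -- since `unaryString 0` is `[false]`.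
  have key : ∀ p, (selfHaltingMachine p).Dom → unaryString (p.length - 1) = p := fun p hp => by
    by_contra hne
    simp [selfHaltingMachine, hne] at hp
  intro p q hp hq hpq
  rw [← key p hp, ← key q hq] at hpq
  rw [← key p hp, ← key q hq, eq_of_unaryString_prefix hpq]

theorem selfHaltingMachine_unaryString_dom (e : ℕ) :
    (selfHaltingMachine (unaryString e)).Dom ↔ e ∈ selfHaltingSet := by
  simp [selfHaltingMachine, length_unaryString, selfHaltingSet]

/-- A computable Ω would make the domain of U decidable, and by universality that domain encodes the
diagonal halting set behind a fixed prefix r. -/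
theorem not_isComputableReal_chaitinOmega {U : List Bool →. List Bool}
    (hU : IsUniversalPrefixFreeMachine U) : ¬ IsComputableReal (chaitinOmega U) := fun h => by
  obtain ⟨r, hr⟩ := hU.2 _ isPrefixFreeMachine_selfHaltingMachine
  have hf : Computable fun e => r ++ unaryString e :=
    Computable.list_append.comp (Computable.const r) computable_unaryString
  refine not_computablePred_selfHaltingSet
    (((computablePred_dom_of_isComputableReal_chaitinOmega hU.1 h).comp hf).of_eq fun e => ?_)
  rw [hr, selfHaltingMachine_unaryString_dom]

/-! ### Countability of the computable reals -/

theorem countable_setOf_computable : {f : ℕ → ℕ | Computable f}.Countable := by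
  have h : {f : ℕ → ℕ | Computable f} ⊆
      ⋃ c : Nat.Partrec.Code, {f : ℕ → ℕ | ∀ n, c.eval n = Part.some (f n)} := fun f hf => by
    obtain ⟨c, hc⟩ := Nat.Partrec.Code.exists_code.1 (Partrec.nat_iff.1 hf)
    exact Set.mem_iUnion.2 ⟨c, fun n => congrFun hc n⟩
  refine (Set.countable_iUnion fun c => Set.Subsingleton.countable fun f hf g hg => ?_).mono h
  exact funext fun n => Part.some_injective ((hf n).symm.trans (hg n))

/-- A triple of computable functions approximates at most one real. -/
theorem countable_setOf_isComputableReal : {x : ℝ | IsComputableReal x}.Countable := by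
  have hc := countable_setOf_computable
  let Q : (ℕ → ℕ) × (ℕ → ℕ) × (ℕ → ℕ) → Set ℝ := fun F =>
    {x | ∀ k, |x - (((F.1 k : ℚ) - (F.2.1 k : ℚ)) / ((F.2.2 k : ℚ) + 1) : ℚ)| ≤ 1 / 2 ^ k}
  refine ((hc.prod (hc.prod hc)).biUnion (t := fun F _ => Q F)
    fun F _ => Set.Subsingleton.countable fun x hx y hy => ?_).mono ?_
  · refine eq_of_forall_dist_le fun ε hε => ?_
    obtain ⟨k, hk⟩ := exists_pow_lt_of_lt_one (half_pos hε) (by norm_num : (1 / 2 : ℝ) < 1)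
    rw [one_div_pow] at hk
    have h1 := abs_le.1 (hx k)
    have h2 := abs_le.1 (hy k)
    rw [Real.dist_eq, abs_le]
    constructor <;> linarith [h1.1, h1.2, h2.1, h2.2]
  · rintro x ⟨q, ⟨f, g, h, hf, hg, hh, hq⟩, hx⟩
    exact Set.mem_biUnion (x := (f, g, h)) ⟨hf, hg, hh⟩ fun k => hq k ▸ hx k

/-! ### Martin-Löf random reals -/

theorem not_isComputableReal_of_isMartinLofRandom {x : ℝ} (hx : IsMartinLofRandom x) :
    ¬ IsComputableReal x := by
  rintro ⟨q, hq, hqx⟩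
  have hs1 : Computable fun y : ℕ × ℕ => y.1 + 1 := Computable.fst.nat_add (Computable.const 1)
  have hs2 : Computable fun y : ℕ × ℕ => y.1 + 2 := Computable.fst.nat_add (Computable.const 2)
  have hr := IsComputableRat.one_div_two_pow hs1
  -- The n-th open set is one interval, repeated for every index, of length exactly 2^(-n). Its
  -- centre is within 2^(-(n+2)) of x, strictly less than its radius 2^(-(n+1)), so x lies in the
  -- open interval.
  refine hx (fun n => ⋃ _ : ℕ, Set.Ioo (((q (n + 2) - 1 / 2 ^ (n + 1) : ℚ)) : ℝ)
    ((q (n + 2) + 1 / 2 ^ (n + 1) : ℚ) : ℝ)) ⟨⟨_, _, (hq.comp hs2).sub hr, (hq.comp hs2).add hr,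
      fun n => rfl⟩, fun n => ?_⟩ (Set.mem_iInter.2 fun n => Set.mem_iUnion.2 ⟨0, ?_⟩)
  · simp only [Set.iUnion_const]
    rw [Real.volume_Ioo]
    refine ENNReal.ofReal_le_ofReal (le_of_eq ?_)
    push_cast
    field_simp
    ring
  · have h := abs_le.1 (hqx (n + 2))
    have h1 : (1 : ℝ) / 2 ^ (n + 1) = 2 * (1 / 2 ^ (n + 2)) := by
      field_simp
      ring
    have h2 : (0 : ℝ) < 1 / 2 ^ (n + 2) := by positivity
    constructor
    · push_cast
      linarith
    · push_cast
      linarith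

/-! ### Assembly of the theorem -/

theorem mainTheorem4 :
    -- the non-computable reals have full measure and are disjoint from EML
    MeasureTheory.volume noncomputableRealsᶜ = 0 ∧
    Disjoint ((fun x : ℝ => (x : ℂ)) '' noncomputableReals) EML ∧
    -- Chaitin's halting probabilities
    (∀ U : List Bool →. List Bool, IsUniversalPrefixFreeMachine U →
      chaitinOmega U ∈ noncomputableReals ∧ (chaitinOmega U : ℂ) ∉ EML) ∧
    -- the binary expansion of the halting set, under each of the usual conventions
    (binaryReal haltingSet ∈ noncomputableReals ∧ (binaryReal haltingSet : ℂ) ∉ EML) ∧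
    (binaryReal selfHaltingSet ∈ noncomputableReals ∧ (binaryReal selfHaltingSet : ℂ) ∉ EML) ∧
    (∀ m : ℕ, binaryReal (inputHaltingSet m) ∈ noncomputableReals ∧
      (binaryReal (inputHaltingSet m) : ℂ) ∉ EML) ∧
    -- limits of Specker sequences
    (∀ (q : ℕ → ℚ) (x : ℝ), IsSpeckerSequence q →
      Filter.Tendsto (fun n => (q n : ℝ)) Filter.atTop (nhds x) →
      x ∈ noncomputableReals ∧ (x : ℂ) ∉ EML) ∧
    -- the classical sequences obtained by enumerating an undecidable set are Specker sequences
    (∀ a : ℕ → ℕ, Computable a → Function.Injective a →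
      ¬ ComputablePred (fun m : ℕ => m ∈ Set.range a) →
      IsSpeckerSequence (fun n => ∑ i ∈ Finset.range n, (1 : ℚ) / 2 ^ (a i + 1))) ∧
    -- Martin-Löf random reals
    (∀ x : ℝ, IsMartinLofRandom x → x ∈ noncomputableReals ∧ (x : ℂ) ∉ EML) := by
  have key : ∀ x : ℝ, ¬ IsComputableReal x → x ∈ noncomputableReals ∧ (x : ℂ) ∉ EML :=
    fun x hx => ⟨hx, notMem_EML_of_not_isComputableReal hx⟩
  refine ⟨?_, ?_, fun U hU => key _ (not_isComputableReal_chaitinOmega hU),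
    key _ not_isComputableReal_binaryReal_haltingSet,
    key _ not_isComputableReal_binaryReal_selfHaltingSet,
    fun m => key _ (not_isComputableReal_binaryReal_inputHaltingSet m), fun q x hq hx => key _ ?_,
    fun a ha hinj hdec => isSpeckerSequence_of_injective ha hinj hdec,
    fun x hx => key _ (not_isComputableReal_of_isMartinLofRandom hx)⟩
  · have e : noncomputableRealsᶜ = {x : ℝ | IsComputableReal x} := by
      ext x
      simp [noncomputableReals]
    rw [e]
    exact countable_setOf_isComputableReal.measure_zero _
  · refine Set.disjoint_left.2 ?_
    rintro _ ⟨x, hx, rfl⟩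
    exact (key x hx).2
  · rw [tendsto_nhds_unique hx
      (tendsto_atTop_ciSup (fun m n hmn => Rat.cast_le.2 (hq.monotone hmn)) hq.bounded)]
    exact hq.noncomputable_sup
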